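/- Let $\mathbb{T}$ be the unit circle with normalized Lebesgue measure $m$, let $H^2\subset L^2(\mathbb{T})$ be the Hardy space of functions whose Fourier coefficients of negative index vanish, and let $u$ be a non-constant inner function, i.e. $u\in L^\infty(\mathbb{T})\cap H^2$ with $|u|=1$ almost everywhere; $u(0)$ denotes the value at $0$ of its holomorphic extension to the unit disc. Let $K_u=H^2\ominus uH^2$, let $P_u$ be the orthogonal projection of $L^2(\mathbb{T})$ onto $K_u$, and for $f\in K_u$ put $$S_uf=P_u(zf),\qquad Cf=u\,\overline{zf},\qquad k_0=P_u1=1-\overline{u(0)}\,u ;$$ $C$ maps $K_u$ to itself. Write $(f\otimes g)h=\langle h,g\rangle f$ with $\langle h,g\rangle=\int_{\mathbb{T}}h\overline{g}\,dm$. For $\alpha\in\mathbb{C}$ with $|\alpha|\le 1$ let $$S_u^\alpha=S_u+\frac{\alpha}{1-\alpha\overline{u(0)}}\;k_0\otimes Ck_0 .$$ A bounded operator $A$ on $K_u$ is said to have the symbol $\Phi\in L^2(\mathbb{T})$ if $Af=P_u(\Phi f)$ for every bounded function $f\in K_u$. It is a truncated Toeplitz operator of type $\alpha$ if it has a symbol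 of the form $\varphi+\alpha\,\overline{S_uC\varphi}+c$ with $\varphi\in K_u$ and $c\in\mathbb{C}$. **Theorem.** Let $\alpha\in\mathbb{C}$ with $|\alpha|\le1$ and let $A$ be a bounded linear operator on $K_u$. Then $A$ is a truncated Toeplitz operator of type $\alpha$ if and only if $AS_u^\alpha=S_u^\alpha A$. -/

import Mathlib

open MeasureTheory AddCircle
open scoped ENNReal ComplexConjugate

namespace TTO

/-- The space `L²(𝕋)` of normalized Lebesgue measure on the unit circle. The circle is parametrized
by `ℝ/ℤ` through `t ↦ e^{2πit}`, so that the coordinate function `z` is `fourier 1`. -/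
abbrev L2 : Type := Lp ℂ 2 (haarAddCircle : Measure UnitAddCircle)

/-- The space `L^∞(𝕋)`. -/
abbrev Linf : Type := Lp ℂ ∞ (haarAddCircle : Measure UnitAddCircle)

/-- The operator `M_g : f ↦ g f` on `L²(𝕋)`, for `g ∈ L^∞(𝕋)`. -/
noncomputable def mulOp (g : Linf) : L2 →L[ℂ] L2 :=
  (ContinuousLinearMap.mul ℂ ℂ).holderL haarAddCircle ∞ 2 2 g

lemma coeFn_mulOp (g : Linf) (f : L2) :
    (mulOp g f : UnitAddCircle → ℂ) =ᵐ[haarAddCircle] fun t => g t * f t :=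
  ContinuousLinearMap.coeFn_holder (r := 2) (ContinuousLinearMap.mul ℂ ℂ) g f

/-- The coordinate function `z`, as an element of `L^∞(𝕋)`. -/
noncomputable def zInf : Linf := fourierLp ∞ 1

/-- The Hardy space `H²`: the functions in `L²(𝕋)` whose Fourier coefficients of negative index
vanish. -/
noncomputable def hardy : Submodule ℂ L2 where
  carrier := {f | ∀ n : ℤ, n < 0 → fourierCoeff f n = 0}
  zero_mem' := by
    intro n _
    rw [← fourierBasis_repr]; simp
  add_mem' := by
    intro f g hf hg n hn
    have h1 := hf n hn
    have h2 := hg n hn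
    rw [← fourierBasis_repr] at h1 h2 ⊢
    simp [h1, h2]
  smul_mem' := by
    intro c f hf n hn
    have h1 := hf n hn
    rw [← fourierBasis_repr] at h1 ⊢
    simp [h1]

lemma mem_hardy_iff (f : L2) : f ∈ hardy ↔ ∀ n : ℤ, n < 0 → fourierCoeff f n = 0 := Iff.rfl

lemma fourierCoeff_eq_inner (f : L2) (n : ℤ) :
    fourierCoeff f n = inner ℂ (fourierLp 2 n : L2) f := by
  rw [← fourierBasis_repr, HilbertBasis.repr_apply_apply, coe_fourierBasis]

lemma isClosed_hardy : IsClosed (hardy : Set L2) := by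
  have : (hardy : Set L2) =
      ⋂ n : ℤ, ⋂ _ : n < 0, {f : L2 | inner ℂ (fourierLp 2 n : L2) f = 0} := by
    ext f
    simp only [SetLike.mem_coe, mem_hardy_iff, fourierCoeff_eq_inner, Set.mem_iInter,
      Set.mem_ofPred_eq]
  rw [this]
  exact isClosed_iInter fun n => isClosed_iInter fun _ =>
    isClosed_eq (by fun_prop) continuous_const

/-- An inner function, given by its boundary function: a function in `L^∞(𝕋)` which is unimodular
almost everywhere and whose Fourier coefficients of negative index vanish. -/
structure InnerFunction where
  toLinf : Linf
  norm_eq_one : ∀ᵐ t ∂(haarAddCircle : Measure UnitAddCircle), ‖toLinf t‖ = 1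
  fourierCoeff_eq_zero : ∀ n : ℤ, n < 0 → fourierCoeff toLinf n = 0

/-- The inner function is not (almost everywhere equal to) a constant. -/
def InnerFunction.Nonconstant (u : InnerFunction) : Prop :=
  ¬ ∃ c : ℂ, ∀ᵐ t ∂(haarAddCircle : Measure UnitAddCircle), u.toLinf t = c

/-- The value at `w`, `|w| < 1`, of the holomorphic extension of a boundary function `f` to the
disc, given by the Cauchy integral `∫ f(ζ) / (1 - w ζ̄) dm(ζ)`. -/
noncomputable def diskValue (f : UnitAddCircle → ℂ) (w : ℂ) : ℂ :=
  ∫ t, f t / (1 - w * conj (fourier 1 t)) ∂(haarAddCircle : Measure UnitAddCircle)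

variable (u : InnerFunction)

/-- The model space `K_u = H² ⊖ uH²`. -/
noncomputable def modelSpace : Submodule ℂ L2 :=
  hardy ⊓ (hardy.map (mulOp u.toLinf).toLinearMap)ᗮ

lemma isClosed_modelSpace : IsClosed (modelSpace u : Set L2) :=
  isClosed_hardy.inter (Submodule.isClosed_orthogonal _)

instance : CompleteSpace (modelSpace u) :=
  (isClosed_modelSpace u).completeSpace_coe

/-- `P_u`, the orthogonal projection of `L²(𝕋)` onto `K_u`. -/
noncomputable def proj : L2 →L[ℂ] modelSpace u :=
  (modelSpace u).orthogonalProjectionOnto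

/-- The conjugation `f ↦ u · conj (z f)` on `L²(𝕋)`. -/
noncomputable def conjL2 (f : L2) : L2 :=
  mulOp u.toLinf (star (mulOp zInf f))

lemma coeFn_conjL2 (f : L2) : (conjL2 u f : UnitAddCircle → ℂ) =ᵐ[haarAddCircle]
    fun t => u.toLinf t * conj (fourier 1 t * f t) := by
  filter_upwards [coeFn_mulOp u.toLinf (star (mulOp zInf f)), Lp.coeFn_star (mulOp zInf f),
    coeFn_mulOp zInf f, coeFn_fourierLp (T := 1) ∞ 1] with t h1 h2 h3 h4
  rw [conjL2, h1, h2, Pi.star_apply, h3, zInf, h4]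
  rfl

lemma inner_eq_integral (f g : L2) :
    inner ℂ f g = ∫ t, conj (f t) * g t ∂(haarAddCircle : Measure UnitAddCircle) := by
  rw [L2.inner_def]
  simp [RCLike.inner_apply, mul_comm]

lemma fourierLp_mem_hardy (n : ℤ) (hn : 0 ≤ n) : (fourierLp 2 n : L2) ∈ hardy := by
  intro m hm
  rw [fourierCoeff_eq_inner]
  exact (orthonormal_fourier (T := 1)).2 (by omega)

/-- `K_u` is invariant under the conjugation. -/
lemma conjL2_mem {f : L2} (hf : f ∈ modelSpace u) : conjL2 u f ∈ modelSpace u := by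
  obtain ⟨hfH, hfO⟩ := hf
  refine ⟨?_, ?_⟩
  · intro n hn
    have h0 : inner ℂ (mulOp u.toLinf (fourierLp 2 (-n - 1) : L2)) f = 0 :=
      hfO _ (Submodule.mem_map_of_mem (fourierLp_mem_hardy _ (by omega)))
    rw [← inner_conj_symm, map_eq_zero, inner_eq_integral] at h0
    rw [fourierCoeff_eq_inner, inner_eq_integral, ← h0]
    refine integral_congr_ae ?_
    filter_upwards [coeFn_conjL2 u f, coeFn_mulOp u.toLinf (fourierLp 2 (-n - 1) : L2),
      coeFn_fourierLp (T := 1) 2 n, coeFn_fourierLp (T := 1) 2 (-n - 1)] with t h1 h2 h3 h4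
    rw [h1, h2, h3, h4, ← fourier_neg, map_mul, ← fourier_neg]
    have : (fourier (-n - 1) t : ℂ) = fourier (-n) t * fourier (-1) t := by
      rw [← fourier_add]; rfl
    rw [this]; ring
  · refine (Submodule.mem_orthogonal _ _).2 ?_
    rintro _ ⟨h, hh, rfl⟩
    -- both `h` and the conjugate of `z f` have disjointly supported Fourier expansions
    have key : inner ℂ h (star (mulOp zInf f)) = 0 := by
      rw [← HilbertBasis.tsum_inner_mul_inner fourierBasis h (star (mulOp zInf f))]
      refine (tsum_congr fun n => ?_).trans tsum_zero
      rw [coe_fourierBasis]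
      rcases lt_or_ge n 0 with hn | hn
      · rw [← inner_conj_symm, ← fourierCoeff_eq_inner, hh n hn]; simp
      · have h1 : fourierCoeff f (-n - 1) = 0 := hfH _ (by omega)
        rw [fourierCoeff_eq_inner, ← map_eq_zero (starRingEnd ℂ), inner_eq_integral,
          ← integral_conj] at h1
        have h2 : inner ℂ (fourierLp 2 n : L2) (star (mulOp zInf f)) = 0 := by
          rw [inner_eq_integral, ← h1]
          refine integral_congr_ae ?_
          filter_upwards [Lp.coeFn_star (mulOp zInf f), coeFn_mulOp zInf f,
            coeFn_fourierLp (T := 1) ∞ 1, coeFn_fourierLp (T := 1) 2 n,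
            coeFn_fourierLp (T := 1) 2 (-n - 1)] with t a1 a2 a3 a4 a5
          rw [a1, Pi.star_apply, a2, zInf, a3, a4, a5, ← fourier_neg, ← fourier_neg]
          have : (fourier (-(-n - 1)) t : ℂ) = fourier n t * fourier 1 t := by
            rw [← fourier_add]; congr 2; ring
          rw [this]
          simp only [map_mul, RCLike.star_def, ← fourier_neg]
          ring
        rw [h2, mul_zero]
    change inner ℂ (mulOp u.toLinf h) (conjL2 u f) = 0
    rw [← key, inner_eq_integral, inner_eq_integral]
    refine integral_congr_ae ?_
    filter_upwards [coeFn_mulOp u.toLinf h, coeFn_mulOp u.toLinf (star (mulOp zInf f)),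
      u.norm_eq_one] with t a1 a2 a3
    rw [conjL2, a1, a2, map_mul]
    have : conj (u.toLinf t) * u.toLinf t = 1 := by
      rw [RCLike.conj_mul, a3]; simp
    linear_combination (conj (h t) * (star (mulOp zInf f) : L2) t) * this

/-- The conjugation `C f = u · conj (z f)`, as a map from `K_u` to itself. -/
noncomputable def conjC (f : modelSpace u) : modelSpace u :=
  ⟨conjL2 u f, conjL2_mem u f.2⟩

/-- The compressed shift `S_u = P_u S`. -/
noncomputable def compShift : modelSpace u →L[ℂ] modelSpace u :=
  proj u ∘L mulOp zInf ∘L (modelSpace u).subtypeL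

/-- The reproducing kernel `k₀ = P_u K₀` of `K_u` at `0`, where `K₀ = 1` is the Szegő kernel
`(1 - λ̄ z)⁻¹` at `λ = 0`. -/
noncomputable def kernelZero : modelSpace u :=
  proj u (Lp.const 2 haarAddCircle 1)

/-- The generalized compressed shift
`S_u^α = S_u + (α / (1 - α · conj (u 0))) k₀ ⊗ C k₀`, where `(f ⊗ g) h = ⟨h, g⟩ f`. -/
noncomputable def genShift (α : ℂ) : modelSpace u →L[ℂ] modelSpace u :=
  compShift u + (α / (1 - α * conj (diskValue u.toLinf 0))) •
    InnerProductSpace.rankOne ℂ (kernelZero u) (conjC u (kernelZero u))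

/-- `A` is the bounded extension to `K_u` of the truncated Toeplitz operator with symbol
`Φ ∈ L²(𝕋)`: `A f = P_u (Φ f)` for every bounded function `f` in `K_u`. -/
def HasSymbol (A : modelSpace u →L[ℂ] modelSpace u) (Φ : L2) : Prop :=
  ∀ (f : modelSpace u) (hf : MemLp (f : L2) ∞ haarAddCircle),
    A f = proj u (mulOp (hf.toLp (f : L2)) Φ)

/-- `A` is a truncated Toeplitz operator of type `α`, for `α ∈ ℂ`: a bounded operator with a symbol
`φ + α · conj (S_u C φ) + c`, where `φ ∈ K_u` and `c ∈ ℂ`. -/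
def IsOfType (α : ℂ) (A : modelSpace u →L[ℂ] modelSpace u) : Prop :=
  ∃ (φ : modelSpace u) (c : ℂ),
    HasSymbol u A ((φ : L2) + α • star (compShift u (conjC u φ) : L2) +
      Lp.const 2 haarAddCircle c)

end TTO

namespace TTO

/-! The vector k₀ is cyclic for S_u^α: the P_u zⁿ with n ≥ 0 span a dense subspace, P_u zⁿ⁺¹ = S_u
P_u zⁿ, and S_u^α - S_u maps into the line of k₀ (`dense_of_kernelZero_mem`). So an operator
commuting with S_u^α is determined by its value at k₀.

For Φ = φ + α·conj(S_u Cφ) + c, the map F ↦ P_u(FΦ) on bounded F intertwines with S_u^α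
(`proj_shiftInf_typeSymbol`). Indeed S_u^α F is zF plus a multiple of α - u, P_u(zh) is S_u P_u h up
to a multiple of k₀, and φ cancels in αP_uΦ - P_u(uΦ) because u·conj(S_u Cφ) = φ - φ(0). What
remains is an identity between multiples of k₀. Density of the bounded functions then gives one
implication.

Conversely, φ and c can be solved for so that P_u(k₀Φ) = Ak₀ (`proj_kernelInf_typeSymbol`). Then A
and the symbol agree on an S_u^α-invariant space of bounded functions containing k₀, hence dense;
duality (`hasSymbol_of_dense`) extends this to all bounded functions, although F ↦ P_u(FΦ) is not
known to be continuous. -/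

/-- The monomial `zⁿ` as an element of `L²(𝕋)`. -/
noncomputable abbrev zPow (n : ℤ) : L2 := fourierLp 2 n

/-- The function `z̄` as an element of `L^∞(𝕋)`. -/
noncomputable def zBar : Linf := fourierLp ∞ (-1)

/-- The inclusion of `L^∞(𝕋)` into `L²(𝕋)`. -/
noncomputable def incl (g : Linf) : L2 := mulOp g (zPow 0)

lemma coeFn_zPow (n : ℤ) : (zPow n : UnitAddCircle → ℂ) =ᵐ[haarAddCircle] fourier n :=
  coeFn_fourierLp 2 n

lemma coeFn_zInf : (zInf : UnitAddCircle → ℂ) =ᵐ[haarAddCircle] fourier 1 :=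
  coeFn_fourierLp ∞ 1

lemma coeFn_zBar : (zBar : UnitAddCircle → ℂ) =ᵐ[haarAddCircle] fourier (-1) :=
  coeFn_fourierLp ∞ (-1)

lemma coeFn_incl (g : Linf) : (incl g : UnitAddCircle → ℂ) =ᵐ[haarAddCircle] g := by
  filter_upwards [coeFn_mulOp g (zPow 0), coeFn_zPow 0] with t h1 h2
  rw [incl, h1, h2]; simp

lemma const_eq_smul_zPow (c : ℂ) : Lp.const 2 haarAddCircle c = c • (zPow 0 : L2) := by
  refine Lp.ext ?_
  filter_upwards [Lp.coeFn_const 2 (haarAddCircle : Measure UnitAddCircle) c,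
    Lp.coeFn_smul c (zPow 0), coeFn_zPow 0] with t h1 h2 h3
  rw [h1, h2, Pi.smul_apply, h3]; simp

lemma mulOp_comm (g h : Linf) (f : L2) : mulOp g (mulOp h f) = mulOp h (mulOp g f) := by
  refine Lp.ext ?_
  filter_upwards [coeFn_mulOp g (mulOp h f), coeFn_mulOp h (mulOp g f), coeFn_mulOp g f,
    coeFn_mulOp h f] with t h1 h2 h3 h4
  rw [h1, h2, h3, h4]; ring

lemma mulOp_add_left (g h : Linf) (f : L2) : mulOp (g + h) f = mulOp g f + mulOp h f := by
  simp [mulOp]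

lemma mulOp_sub_left (g h : Linf) (f : L2) : mulOp (g - h) f = mulOp g f - mulOp h f := by
  simp [mulOp]

lemma mulOp_smul_left (c : ℂ) (g : Linf) (f : L2) : mulOp (c • g) f = c • mulOp g f := by
  simp [mulOp]

lemma mulOp_const_one (f : L2) : mulOp (Lp.const ∞ haarAddCircle (1 : ℂ)) f = f := by
  refine Lp.ext ?_
  filter_upwards [coeFn_mulOp (Lp.const ∞ haarAddCircle (1 : ℂ)) f,
    Lp.coeFn_const ∞ (haarAddCircle : Measure UnitAddCircle) (1 : ℂ)] with t h1 h2
  rw [h1, h2]; simp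

lemma mulOp_zBar_zInf (f : L2) : mulOp zBar (mulOp zInf f) = f := by
  refine Lp.ext ?_
  filter_upwards [coeFn_mulOp zBar (mulOp zInf f), coeFn_mulOp zInf f, coeFn_zInf,
    coeFn_zBar] with t h1 h2 h3 h4
  rw [h1, h2, h3, h4, ← mul_assoc, ← fourier_add]; simp

lemma mulOp_zInf_zBar (f : L2) : mulOp zInf (mulOp zBar f) = f := by
  rw [mulOp_comm, mulOp_zBar_zInf]

lemma mulOp_zInf_zPow (n : ℤ) : mulOp zInf (zPow n) = zPow (n + 1) := by
  refine Lp.ext ?_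
  filter_upwards [coeFn_mulOp zInf (zPow n), coeFn_zInf, coeFn_zPow n,
    coeFn_zPow (n + 1)] with t h1 h2 h3 h4
  rw [h1, h2, h3, h4, ← fourier_add, add_comm]

lemma mulOp_zBar_zPow (n : ℤ) : mulOp zBar (zPow n) = zPow (n - 1) := by
  rw [← mulOp_zBar_zInf (zPow (n - 1)), mulOp_zInf_zPow, sub_add_cancel]

/-- The product of two functions in `L^∞(𝕋)`. -/
noncomputable def mulInf (g h : Linf) : Linf :=
  (ContinuousLinearMap.mul ℂ ℂ).holder ∞ g h

lemma coeFn_mulInf (g h : Linf) :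
    (mulInf g h : UnitAddCircle → ℂ) =ᵐ[haarAddCircle] fun t => g t * h t :=
  ContinuousLinearMap.coeFn_holder (r := ∞) (ContinuousLinearMap.mul ℂ ℂ) g h

lemma mulOp_mulInf (g h : Linf) (f : L2) : mulOp (mulInf g h) f = mulOp g (mulOp h f) := by
  refine Lp.ext ?_
  filter_upwards [coeFn_mulOp (mulInf g h) f, coeFn_mulOp g (mulOp h f), coeFn_mulOp h f,
    coeFn_mulInf g h] with t h1 h2 h3 h4
  rw [h1, h2, h3, h4, mul_assoc]

lemma inner_mulOp_star_left (g : Linf) (f h : L2) :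
    inner ℂ (mulOp (star g) f) h = inner ℂ f (mulOp g h) := by
  rw [inner_eq_integral, inner_eq_integral]
  refine integral_congr_ae ?_
  filter_upwards [coeFn_mulOp (star g) f, coeFn_mulOp g h, Lp.coeFn_star g] with t h1 h2 h3
  rw [h1, h2, h3, Pi.star_apply, map_mul, RCLike.star_def, Complex.conj_conj]; ring

lemma inner_mulOp_mulOp {g : Linf} (hg : ∀ᵐ t ∂(haarAddCircle : Measure UnitAddCircle), ‖g t‖ = 1)
    (f h : L2) : inner ℂ (mulOp g f) (mulOp g h) = inner ℂ f h := by
  rw [inner_eq_integral, inner_eq_integral]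
  refine integral_congr_ae ?_
  filter_upwards [coeFn_mulOp g f, coeFn_mulOp g h, hg] with t h1 h2 h3
  have : conj (g t) * g t = 1 := by rw [RCLike.conj_mul, h3]; simp
  rw [h1, h2, map_mul]
  linear_combination (conj (f t) * h t) * this

lemma norm_zInf : ∀ᵐ t ∂(haarAddCircle : Measure UnitAddCircle), ‖zInf t‖ = 1 := by
  filter_upwards [coeFn_zInf] with t h
  rw [h, fourier_one]
  exact Circle.norm_coe _

lemma inner_zPow_mulOp_zInf (n : ℤ) (f : L2) :
    inner ℂ (zPow n) (mulOp zInf f) = inner ℂ (zPow (n - 1)) f := by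
  rw [← inner_mulOp_mulOp norm_zInf (zPow (n - 1)) f, mulOp_zInf_zPow, sub_add_cancel]

lemma inner_mulOp_zBar (f h : L2) : inner ℂ (mulOp zBar f) h = inner ℂ f (mulOp zInf h) := by
  rw [← inner_mulOp_mulOp norm_zInf, mulOp_zInf_zBar]

lemma inner_mulOp_zBar_right (f h : L2) :
    inner ℂ f (mulOp zBar h) = inner ℂ (mulOp zInf f) h := by
  rw [← inner_mulOp_mulOp norm_zInf, mulOp_zInf_zBar]

lemma inner_zPow_zPow (m n : ℤ) : inner ℂ (zPow m) (zPow n) = if m = n then (1 : ℂ) else 0 :=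
  orthonormal_iff_ite.1 (orthonormal_fourier (T := 1)) m n

lemma mem_hardy_iff_inner (f : L2) : f ∈ hardy ↔ ∀ n : ℤ, n < 0 → inner ℂ (zPow n) f = 0 := by
  simp only [mem_hardy_iff, fourierCoeff_eq_inner]

/-! ### Fourier coefficients of products, and the backward shift. -/

lemma inner_mulOp_zPow (g : Linf) (n m : ℤ) :
    inner ℂ (zPow n) (mulOp g (zPow m)) = inner ℂ (zPow (n - m)) (incl g) := by
  rw [inner_eq_integral, inner_eq_integral]
  refine integral_congr_ae ?_
  filter_upwards [coeFn_mulOp g (zPow m), coeFn_incl g, coeFn_zPow n, coeFn_zPow m,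
    coeFn_zPow (n - m)] with t h1 h2 h3 h4 h5
  rw [h1, h2, h3, h4, h5, ← fourier_neg, ← fourier_neg]
  have : (fourier (-(n - m)) t : ℂ) = fourier (-n) t * fourier m t := by
    rw [← fourier_add]; congr 2; ring
  rw [this]; ring

/-- The coefficients of nonpositive index of a product of two functions in `H²`. -/
lemma inner_zPow_mulOp_of_mem_hardy {g : Linf} {f : L2} (hg : incl g ∈ hardy) (hf : f ∈ hardy)
    {n : ℤ} (hn : n ≤ 0) :
    inner ℂ (zPow n) (mulOp g f) = inner ℂ (zPow n) (incl g) * inner ℂ (zPow 0) f := by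
  rw [mem_hardy_iff_inner] at hg hf
  rw [← inner_mulOp_star_left, ← HilbertBasis.tsum_inner_mul_inner fourierBasis, coe_fourierBasis,
    tsum_eq_single 0]
  · rw [inner_mulOp_star_left, inner_mulOp_zPow, sub_zero]
  -- Only m = 0 survives: f has no coefficient at m < 0, and g none at n - m < 0, which covers m > 0
  -- since n ≤ 0.
  · intro m hm
    rcases lt_or_gt_of_ne hm with hm | hm
    · rw [hf m hm, mul_zero]
    · rw [inner_mulOp_star_left, inner_mulOp_zPow, hg _ (by omega), zero_mul]

lemma mulOp_mem_hardy {g : Linf} {f : L2} (hg : incl g ∈ hardy) (hf : f ∈ hardy) :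
    mulOp g f ∈ hardy := by
  rw [mem_hardy_iff_inner]
  intro n hn
  rw [inner_zPow_mulOp_of_mem_hardy hg hf hn.le, (mem_hardy_iff_inner _).1 hg n hn, zero_mul]

lemma incl_zInf : incl zInf = zPow 1 := by
  rw [incl, mulOp_zInf_zPow, zero_add]

lemma mulOp_zInf_mem_hardy {f : L2} (hf : f ∈ hardy) : mulOp zInf f ∈ hardy :=
  mulOp_mem_hardy (by rw [incl_zInf]; exact fourierLp_mem_hardy 1 (by norm_num)) hf

lemma inner_zPow_zero_mulOp_zInf {f : L2} (hf : f ∈ hardy) :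
    inner ℂ (zPow 0) (mulOp zInf f) = 0 := by
  rw [inner_zPow_mulOp_zInf]
  exact (mem_hardy_iff_inner _).1 hf _ (by norm_num)

/-- The backward shift `f ↦ z̄ (f - f(0))`. -/
noncomputable def backShift (f : L2) : L2 :=
  mulOp zBar (f - (inner ℂ (zPow 0) f : ℂ) • zPow 0)

lemma mulOp_zInf_backShift (f : L2) :
    mulOp zInf (backShift f) = f - (inner ℂ (zPow 0) f : ℂ) • zPow 0 :=
  mulOp_zInf_zBar _

lemma backShift_mem_hardy {f : L2} (hf : f ∈ hardy) : backShift f ∈ hardy := by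
  rw [mem_hardy_iff_inner] at hf ⊢
  intro n hn
  rw [backShift, inner_mulOp_zBar_right, mulOp_zInf_zPow, inner_sub_right, inner_smul_right,
    inner_zPow_zPow]
  rcases eq_or_ne (n + 1) 0 with h | h
  · simp [h]
  · rw [hf _ (by omega), if_neg h]; simp

/-! ### The model space, its projection, k₀ and the compressed shift. -/

variable (u : InnerFunction)

lemma incl_mem_hardy : incl u.toLinf ∈ hardy := by
  intro n hn
  rw [← u.fourierCoeff_eq_zero n hn]
  exact integral_congr_ae <| by
    filter_upwards [coeFn_incl u.toLinf] with t h
    rw [h]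

lemma mem_modelSpace_iff (f : L2) :
    f ∈ modelSpace u ↔ f ∈ hardy ∧ ∀ h ∈ hardy, inner ℂ (mulOp u.toLinf h) f = 0 := by
  refine and_congr_right fun _ => ?_
  refine (Submodule.mem_orthogonal _ _).trans ?_
  refine ⟨fun H h hh => H _ (Submodule.mem_map_of_mem hh), ?_⟩
  rintro H _ ⟨h, hh, rfl⟩
  exact H h hh

/-- For h in H² the function zuh is in uH² and vanishes at 0, so it is orthogonal both to f and to
the subtracted constant. -/
lemma backShift_mem {f : L2} (hf : f ∈ modelSpace u) : backShift f ∈ modelSpace u := by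
  rw [mem_modelSpace_iff] at hf ⊢
  refine ⟨backShift_mem_hardy hf.1, fun h hh => ?_⟩
  rw [backShift, inner_mulOp_zBar_right, mulOp_comm, inner_sub_right,
    hf.2 _ (mulOp_zInf_mem_hardy hh), inner_smul_right, mulOp_comm,
    ← inner_conj_symm (mulOp zInf _), inner_zPow_zero_mulOp_zInf (mulOp_mem_hardy (incl_mem_hardy u) hh)]
  simp

lemma proj_eq_zero_iff (h : L2) : proj u h = 0 ↔ ∀ f ∈ modelSpace u, inner ℂ f h = 0 := by
  rw [proj, Submodule.orthogonalProjectionOnto_eq_zero_iff, Submodule.mem_orthogonal]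

lemma proj_coe (f : modelSpace u) : proj u (f : L2) = f :=
  Submodule.orthogonalProjectionOnto_mem_subspace_eq_self f

lemma inner_proj (f : modelSpace u) (h : L2) : inner ℂ f (proj u h) = inner ℂ (f : L2) h :=
  Submodule.inner_orthogonalProjectionOnto_eq_of_mem_left f h

lemma proj_mulOp_of_mem_hardy {h : L2} (hh : h ∈ hardy) : proj u (mulOp u.toLinf h) = 0 := by
  rw [proj_eq_zero_iff]
  intro f hf
  rw [← inner_conj_symm, ((mem_modelSpace_iff u f).1 hf).2 h hh, map_zero]

lemma proj_incl : proj u (incl u.toLinf) = 0 :=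
  proj_mulOp_of_mem_hardy u (fourierLp_mem_hardy 0 le_rfl)

lemma kernelZero_eq_proj : kernelZero u = proj u (zPow 0) := by
  rw [kernelZero, const_eq_smul_zPow, one_smul]

lemma inner_mulOp_left (f h : L2) : inner ℂ (mulOp u.toLinf f) (mulOp u.toLinf h) = inner ℂ f h :=
  inner_mulOp_mulOp u.norm_eq_one f h

/-- `u(0)` -/
lemma diskValue_eq_inner : diskValue u.toLinf 0 = inner ℂ (zPow 0) (incl u.toLinf) := by
  rw [diskValue, inner_eq_integral]
  refine integral_congr_ae ?_
  filter_upwards [coeFn_incl u.toLinf, coeFn_zPow 0] with t h1 h2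
  rw [h1, h2]; simp

lemma coe_kernelZero : (kernelZero u : L2) =
    zPow 0 - conj (diskValue u.toLinf 0) • incl u.toLinf := by
  have hmem : zPow 0 - conj (diskValue u.toLinf 0) • incl u.toLinf ∈ modelSpace u := by
    rw [mem_modelSpace_iff]
    refine ⟨sub_mem (fourierLp_mem_hardy 0 le_rfl) (hardy.smul_mem _ (incl_mem_hardy u)), ?_⟩
    intro h hh
    rw [inner_sub_right, inner_smul_right, incl, inner_mulOp_left, diskValue_eq_inner,
      ← inner_conj_symm, inner_zPow_mulOp_of_mem_hardy (incl_mem_hardy u) hh le_rfl, map_mul,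
      inner_conj_symm h, sub_self]
  have := proj_coe u ⟨_, hmem⟩
  rw [map_sub, map_smul, proj_incl, smul_zero, sub_zero] at this
  rw [kernelZero_eq_proj, this]

/-- Since f ⊥ uH², zf is orthogonal to zuH²; its only component in uH² is therefore along u itself.
-/
lemma coe_compShift (f : modelSpace u) : (compShift u f : L2) =
    mulOp zInf f - (inner ℂ (incl u.toLinf) (mulOp zInf f) : ℂ) • incl u.toLinf := by
  have hf := (mem_modelSpace_iff u f).1 f.2
  have hmem : mulOp zInf f - (inner ℂ (incl u.toLinf) (mulOp zInf (f : L2)) : ℂ) • incl u.toLinf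
      ∈ modelSpace u := by
    rw [mem_modelSpace_iff]
    refine ⟨sub_mem (mulOp_zInf_mem_hardy hf.1) (hardy.smul_mem _ (incl_mem_hardy u)), ?_⟩
    intro h hh
    have h1 : h = mulOp zInf (backShift h) + (inner ℂ (zPow 0) h : ℂ) • zPow 0 := by
      rw [mulOp_zInf_backShift, sub_add_cancel]
    have h2 : inner ℂ (mulOp u.toLinf h) (mulOp zInf (f : L2)) =
        conj (inner ℂ (zPow 0) h) * inner ℂ (incl u.toLinf) (mulOp zInf (f : L2)) := by
      conv_lhs => rw [h1]
      rw [map_add, map_smul, inner_add_left, inner_smul_left, mulOp_comm,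
        inner_mulOp_mulOp norm_zInf, hf.2 _ (backShift_mem_hardy hh), zero_add, incl]
    have h3 : inner ℂ (mulOp u.toLinf h) (incl u.toLinf) = conj (inner ℂ (zPow 0) h : ℂ) := by
      rw [incl, inner_mulOp_left, inner_conj_symm]
    rw [inner_sub_right, inner_smul_right, h2, h3]
    ring
  have := proj_coe u ⟨_, hmem⟩
  rw [map_sub, map_smul, proj_incl, smul_zero, sub_zero] at this
  change ((proj u (mulOp zInf f) : modelSpace u) : L2) = _
  rw [this]

/-- By duality: for g in K_u, the part of z̄g outside K_u is g(0)z̄. Here h is any L² function,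
which is needed for h = FΦ. -/
lemma proj_mulOp_zInf (h : L2) : proj u (mulOp zInf h) =
    compShift u (proj u h) + (inner ℂ (zPow (-1)) h : ℂ) • kernelZero u := by
  refine ext_inner_left ℂ fun g => ?_
  have hsplit : mulOp zBar (g : L2) =
      backShift g + (inner ℂ (zPow 0) (g : L2) : ℂ) • zPow (-1) := by
    rw [backShift, map_sub, map_smul, mulOp_zBar_zPow]
    simp
  have hp : inner ℂ (zPow (-1)) (proj u h : L2) = 0 :=
    (mem_hardy_iff_inner _).1 ((mem_modelSpace_iff u _).1 (proj u h).2).1 _ (by norm_num)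
  have h1 : inner ℂ g (compShift u (proj u h)) = inner ℂ (backShift g) h := by
    change inner ℂ g (proj u (mulOp zInf (proj u h : L2))) = _
    rw [inner_proj, ← inner_mulOp_zBar, hsplit, inner_add_left, inner_smul_left, hp, mul_zero,
      add_zero, ← inner_proj u ⟨_, backShift_mem u g.2⟩ h]
    rfl
  rw [inner_proj, ← inner_mulOp_zBar, hsplit, inner_add_left, inner_smul_left, inner_add_right,
    h1, kernelZero_eq_proj]
  congr 1
  refine Eq.trans ?_ (inner_smul_right g (proj u (zPow 0)) _).symm
  rw [inner_proj, inner_conj_symm, mul_comm]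

lemma inner_zPow_star (n : ℤ) (f : L2) :
    inner ℂ (zPow n) (star f) = conj (inner ℂ (zPow (-n)) f : ℂ) := by
  rw [inner_eq_integral, inner_eq_integral, ← integral_conj]
  refine integral_congr_ae ?_
  filter_upwards [Lp.coeFn_star f, coeFn_zPow n, coeFn_zPow (-n)] with t h1 h2 h3
  rw [h1, h2, h3, fourier_neg]; simp

/-- The spectra of conj h and of an element of K_u can only meet at index 0. -/
lemma proj_star_of_mem_hardy {h : L2} (hh : h ∈ hardy) :
    proj u (star h) = conj (inner ℂ (zPow 0) h : ℂ) • kernelZero u := by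
  rw [kernelZero_eq_proj, ← map_smul, ← sub_eq_zero, ← map_sub, proj_eq_zero_iff]
  intro g hg
  rw [mem_hardy_iff_inner] at hh
  have hg' := (mem_hardy_iff_inner _).1 ((mem_modelSpace_iff u g).1 hg).1
  rw [inner_sub_right, sub_eq_zero, ← HilbertBasis.tsum_inner_mul_inner fourierBasis,
    coe_fourierBasis, tsum_eq_single 0, inner_zPow_star, neg_zero, inner_smul_right, mul_comm]
  intro m hm
  rcases lt_or_gt_of_ne hm with hm | hm
  · rw [← inner_conj_symm, hg' m hm, map_zero, zero_mul]
  · rw [inner_zPow_star, hh _ (by omega), map_zero, mul_zero]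

/-! ### The denominator, and an explicit form of S_u^α. -/

/-- ‖u - u(0)‖² = 1 - |u(0)|², so |u(0)| ≥ 1 would force u to be constant. -/
lemma norm_diskValue_lt_one (hu : u.Nonconstant) : ‖diskValue u.toLinf 0‖ < 1 := by
  by_contra! hge
  set a := diskValue u.toLinf 0 with ha
  have h1 : inner ℂ (incl u.toLinf) (incl u.toLinf) = (1 : ℂ) := by
    rw [incl, inner_mulOp_left, inner_zPow_zPow, if_pos rfl]
  have h2 : inner ℂ (incl u.toLinf - a • zPow 0) (incl u.toLinf - a • zPow 0) =
      ((1 - ‖a‖ ^ 2 : ℝ) : ℂ) := by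
    rw [inner_sub_left, inner_sub_right, inner_sub_right, h1, inner_smul_left, inner_smul_left,
      inner_smul_right, inner_smul_right, ← inner_conj_symm (incl _), ← diskValue_eq_inner, ← ha,
      inner_zPow_zPow, if_pos rfl]
    have : conj a * a = (‖a‖ : ℂ) ^ 2 := RCLike.conj_mul a
    push_cast
    rw [← this]
    ring
  have h3 : ‖incl u.toLinf - a • (zPow 0 : L2)‖ ^ 2 = 1 - ‖a‖ ^ 2 := by
    rw [← inner_self_eq_norm_sq (𝕜 := ℂ), h2]
    exact Complex.ofReal_re _
  have h4 : ‖incl u.toLinf - a • (zPow 0 : L2)‖ = 0 := by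
    nlinarith [norm_nonneg (incl u.toLinf - a • (zPow 0 : L2))]
  have h5 := sub_eq_zero.1 (norm_eq_zero.1 h4)
  refine hu ⟨a, ?_⟩
  filter_upwards [coeFn_incl u.toLinf, Lp.coeFn_smul a (zPow 0), coeFn_zPow 0] with t k1 k2 k3
  rw [← k1, h5, k2, Pi.smul_apply, k3]; simp

lemma one_sub_mul_conj_diskValue_ne_zero (hu : u.Nonconstant) {α : ℂ} (hα : ‖α‖ ≤ 1) :
    1 - α * conj (diskValue u.toLinf 0) ≠ 0 := by
  intro h
  have h1 : ‖α * conj (diskValue u.toLinf 0)‖ = 1 := by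
    rw [← sub_eq_zero.1 h, norm_one]
  rw [norm_mul, RCLike.norm_conj] at h1
  nlinarith [norm_diskValue_lt_one u hu, norm_nonneg α, norm_nonneg (diskValue u.toLinf 0)]

lemma coe_conjC_kernelZero : (conjC u (kernelZero u) : L2) =
    mulOp zBar (incl u.toLinf) - diskValue u.toLinf 0 • zPow (-1) := by
  change conjL2 u (kernelZero u) = _
  rw [coe_kernelZero]
  set a := diskValue u.toLinf 0
  refine Lp.ext ?_
  filter_upwards [coeFn_conjL2 u (zPow 0 - conj a • incl u.toLinf),
    Lp.coeFn_sub (zPow 0) (conj a • incl u.toLinf), Lp.coeFn_smul (conj a) (incl u.toLinf),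
    coeFn_zPow 0, coeFn_zPow (-1), coeFn_incl u.toLinf, u.norm_eq_one,
    Lp.coeFn_sub (mulOp zBar (incl u.toLinf)) (a • zPow (-1)), Lp.coeFn_smul a (zPow (-1)),
    coeFn_mulOp zBar (incl u.toLinf), coeFn_zBar] with t h1 h2 h3 h4 h5 h6 h7 h8 h9 h10 h11
  have hu : u.toLinf t * conj (u.toLinf t) = 1 := by rw [RCLike.mul_conj, h7]; simp
  rw [h1, h2, Pi.sub_apply, h3, Pi.smul_apply, h4, h6, h8, Pi.sub_apply, h9, Pi.smul_apply, h10,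
    h11, h5, h6, fourier_neg, map_mul, map_sub, smul_eq_mul, smul_eq_mul, map_mul,
    Complex.conj_conj, fourier_zero, map_one]
  linear_combination -(a * conj (fourier 1 t : ℂ)) * hu

lemma inner_conjC_kernelZero {f : L2} : inner ℂ (conjC u (kernelZero u) : L2) f =
    inner ℂ (mulOp zBar (incl u.toLinf)) f -
      conj (diskValue u.toLinf 0) * inner ℂ (zPow (-1)) f := by
  rw [coe_conjC_kernelZero, inner_sub_left, inner_smul_left]

lemma genShift_apply (α : ℂ) (f : modelSpace u) : genShift u α f = compShift u f +
    ((α / (1 - α * conj (diskValue u.toLinf 0))) * inner ℂ (conjC u (kernelZero u) : L2) (f : L2)) •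
      kernelZero u := by
  rw [mul_smul]
  rfl

/-- Elements of K_u are orthogonal to z̄, so Ck₀ acts on them as z̄u; the two rank-one terms then
merge into a multiple of α - u. As α - u is bounded, S_u^α preserves boundedness. -/
lemma coe_genShift {α : ℂ} (h : 1 - α * conj (diskValue u.toLinf 0) ≠ 0) (f : modelSpace u) :
    (genShift u α f : L2) = mulOp zInf f +
      ((1 - α * conj (diskValue u.toLinf 0))⁻¹ * inner ℂ (mulOp zBar (incl u.toLinf)) (f : L2)) •
        (α • zPow 0 - incl u.toLinf) := by
  have hz : inner ℂ (zPow (-1)) (f : L2) = 0 :=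
    (mem_hardy_iff_inner _).1 ((mem_modelSpace_iff u _).1 f.2).1 _ (by norm_num)
  rw [genShift_apply, Submodule.coe_add, Submodule.coe_smul, coe_compShift, coe_kernelZero,
    inner_conjC_kernelZero, hz, ← inner_mulOp_zBar]
  match_scalars <;> field_simp
  all_goals ring

/-! ### Symbols of type α and their compressions. -/

/-- `S_u C φ = u · conj (φ - φ(0))`. -/
lemma mulOp_star_compShift_conjC (φ : modelSpace u) :
    mulOp u.toLinf (star (compShift u (conjC u φ) : L2)) =
      (φ : L2) - (inner ℂ (zPow 0) (φ : L2) : ℂ) • zPow 0 := by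
  set a : ℂ := inner ℂ (zPow 0) (φ : L2) with ha
  -- z·Cφ = u·conj φ, and the factor u cancels in the pairing.
  have hb : inner ℂ (incl u.toLinf) (mulOp zInf (conjC u φ)) = conj a := by
    rw [ha, inner_eq_integral, inner_eq_integral, ← integral_conj]
    refine integral_congr_ae ?_
    filter_upwards [coeFn_incl u.toLinf, coeFn_mulOp zInf (conjC u φ), coeFn_conjL2 u φ,
      coeFn_zInf, coeFn_zPow 0, u.norm_eq_one] with t h1 h2 h3 h4 h5 h6
    have hu : conj (u.toLinf t) * u.toLinf t = 1 := by rw [RCLike.conj_mul, h6]; simp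
    have hz : (fourier 1 t : ℂ) * conj (fourier 1 t : ℂ) = 1 := by
      rw [← fourier_neg, ← fourier_add]; simp
    change (conjC u φ : L2) t = _ at h3
    rw [h1, h2, h3, h4, h5, map_mul, map_mul, fourier_zero, Complex.conj_conj]
    linear_combination conj ((φ : L2) t) * (hu + conj (u.toLinf t) * u.toLinf t * hz)
  rw [coe_compShift, hb]
  refine Lp.ext ?_
  filter_upwards [coeFn_mulOp u.toLinf (star (mulOp zInf (conjC u φ) - conj a • incl u.toLinf)),
    Lp.coeFn_star (mulOp zInf (conjC u φ) - conj a • incl u.toLinf),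
    Lp.coeFn_sub (mulOp zInf (conjC u φ)) (conj a • incl u.toLinf),
    Lp.coeFn_smul (conj a) (incl u.toLinf), coeFn_incl u.toLinf,
    coeFn_mulOp zInf (conjC u φ), coeFn_conjL2 u φ, coeFn_zInf, u.norm_eq_one,
    Lp.coeFn_sub (φ : L2) (a • zPow 0), Lp.coeFn_smul a (zPow 0), coeFn_zPow 0]
    with t h1 h2 h3 h4 h5 h6 h7 h8 h9 h10 h11 h12
  have hu : u.toLinf t * conj (u.toLinf t) = 1 := by rw [RCLike.mul_conj, h9]; simp
  have hz : conj (fourier 1 t : ℂ) * fourier 1 t = 1 := by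
    rw [← fourier_neg, ← fourier_add]; simp
  change (conjC u φ : L2) t = _ at h7
  rw [h1, h2, Pi.star_apply, h3, Pi.sub_apply, h4, Pi.smul_apply, h5, h6, h7, h8, h10,
    Pi.sub_apply, h11, Pi.smul_apply, h12, fourier_zero]
  simp only [RCLike.star_def, map_sub, map_mul, smul_eq_mul, Complex.conj_conj]
  linear_combination (conj (fourier 1 t : ℂ) * fourier 1 t * (φ : L2) t - a) * hu + (φ : L2) t * hz

/-- The symbol `φ + α · conj (S_u C φ) + c`. -/
noncomputable def typeSymbol (α : ℂ) (φ : modelSpace u) (c : ℂ) : L2 :=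
  (φ : L2) + α • star (compShift u (conjC u φ) : L2) + c • zPow 0

/-- The value of `S_u C φ` at `0`. -/
noncomputable def companionValue (φ : modelSpace u) : ℂ :=
  inner ℂ (zPow 0) (compShift u (conjC u φ) : L2)

lemma proj_typeSymbol (α : ℂ) (φ : modelSpace u) (c : ℂ) : proj u (typeSymbol u α φ c) =
    φ + (α * conj (companionValue u φ) + c) • kernelZero u := by
  rw [typeSymbol, map_add, map_add, map_smul, map_smul, proj_coe,
    proj_star_of_mem_hardy u ((mem_modelSpace_iff u _).1 (compShift u (conjC u φ)).2).1,
    ← kernelZero_eq_proj, companionValue]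
  module

/-- Multiplication by u sends φ and c into uH², which P_u kills, and turns the conjugated term back
into φ - φ(0). -/
lemma proj_mulOp_typeSymbol (α : ℂ) (φ : modelSpace u) (c : ℂ) :
    proj u (mulOp u.toLinf (typeSymbol u α φ c)) =
      α • (φ - (inner ℂ (zPow 0) (φ : L2) : ℂ) • kernelZero u) := by
  simp only [typeSymbol, map_add, map_smul, mulOp_star_compShift_conjC, map_sub]
  rw [proj_mulOp_of_mem_hardy u ((mem_modelSpace_iff u _).1 φ.2).1, proj_coe,
    proj_mulOp_of_mem_hardy u (fourierLp_mem_hardy 0 le_rfl), ← kernelZero_eq_proj]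
  module

/-- The bounded function `k₀`. -/
noncomputable def kernelInf : Linf :=
  Lp.const ∞ haarAddCircle (1 : ℂ) - conj (diskValue u.toLinf 0) • u.toLinf

lemma incl_kernelInf : incl (kernelInf u) = kernelZero u := by
  rw [coe_kernelZero, incl, kernelInf, mulOp_sub_left, mulOp_smul_left, mulOp_const_one, incl]

lemma proj_kernelInf_typeSymbol (α : ℂ) (φ : modelSpace u) (c : ℂ) :
    proj u (mulOp (kernelInf u) (typeSymbol u α φ c)) =
      (1 - α * conj (diskValue u.toLinf 0)) • φ + (c + α * conj (companionValue u φ) +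
        α * conj (diskValue u.toLinf 0) * inner ℂ (zPow 0) (φ : L2)) • kernelZero u := by
  rw [kernelInf, mulOp_sub_left, mulOp_smul_left, mulOp_const_one, map_sub, map_smul,
    proj_typeSymbol, proj_mulOp_typeSymbol]
  module

/-! ### Intertwining with S_u^α on bounded functions. -/

/-- The bounded representative of `S_u^α F`, for a bounded function `F ∈ K_u`. -/
noncomputable def shiftInf (α : ℂ) (F : Linf) : Linf :=
  mulInf zInf F + ((1 - α * conj (diskValue u.toLinf 0))⁻¹ *
    inner ℂ (mulOp zBar (incl u.toLinf)) (incl F)) •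
      (α • Lp.const ∞ haarAddCircle (1 : ℂ) - u.toLinf)

lemma mulOp_shiftInf (α : ℂ) (F : Linf) (h : L2) : mulOp (shiftInf u α F) h =
    mulOp zInf (mulOp F h) + ((1 - α * conj (diskValue u.toLinf 0))⁻¹ *
      inner ℂ (mulOp zBar (incl u.toLinf)) (incl F)) • (α • h - mulOp u.toLinf h) := by
  rw [shiftInf, mulOp_add_left, mulOp_smul_left, mulOp_sub_left, mulOp_smul_left, mulOp_mulInf,
    mulOp_const_one]

lemma incl_shiftInf {α : ℂ} (hα : 1 - α * conj (diskValue u.toLinf 0) ≠ 0) {F : Linf}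
    (hF : incl F ∈ modelSpace u) : incl (shiftInf u α F) = genShift u α ⟨incl F, hF⟩ := by
  rw [coe_genShift u hα, incl, mulOp_shiftInf]
  rfl

lemma inner_zPow_mulOp_star (F : Linf) (φ : modelSpace u) :
    inner ℂ (zPow (-1)) (mulOp F (star (compShift u (conjC u φ) : L2))) =
      inner ℂ (mulOp zBar (incl u.toLinf)) (mulOp F φ) -
        inner ℂ (zPow 0) (φ : L2) * inner ℂ (mulOp zBar (incl u.toLinf)) (incl F) := by
  rw [← inner_mulOp_left u, mulOp_comm u.toLinf F, mulOp_star_compShift_conjC, map_sub, map_smul,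
    inner_sub_right, inner_smul_right]
  have : mulOp u.toLinf (zPow (-1)) = mulOp zBar (incl u.toLinf) := by
    rw [incl, mulOp_comm, mulOp_zBar_zPow, zero_sub]
  rw [this, incl, incl]

/-- Up to conjugation, the left side is the coefficient at 0 of CF·ψ, a product of two H² functions,
hence multiplicative. The function G below is the bounded representative of CF. -/
lemma inner_incl_mulOp_star {F : Linf} (hF : incl F ∈ modelSpace u) (ψ : modelSpace u) :
    inner ℂ (mulOp zBar (incl u.toLinf)) (mulOp F (star (ψ : L2))) =
      conj (inner ℂ (zPow 0) (ψ : L2) : ℂ) *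
        inner ℂ (mulOp zBar (incl u.toLinf)) (incl F) := by
  set G : Linf := mulInf u.toLinf (star (mulInf zInf F)) with hG
  have hGt : ∀ᵐ t ∂(haarAddCircle : Measure UnitAddCircle),
      G t = u.toLinf t * conj ((fourier 1 t : ℂ) * F t) := by
    filter_upwards [coeFn_mulInf u.toLinf (star (mulInf zInf F)), Lp.coeFn_star (mulInf zInf F),
      coeFn_mulInf zInf F, coeFn_zInf] with t h1 h2 h3 h4
    rw [hG, h1, h2, Pi.star_apply, h3, h4, RCLike.star_def]
  have hGi : incl G = conjL2 u (incl F) := by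
    refine Lp.ext ?_
    filter_upwards [coeFn_incl G, hGt, coeFn_conjL2 u (incl F), coeFn_incl F] with t h1 h2 h3 h4
    rw [h1, h2, h3, h4]
  have hGh : incl G ∈ hardy := by
    rw [hGi]; exact ((mem_modelSpace_iff u _).1 (conjL2_mem u hF)).1
  have key := inner_zPow_mulOp_of_mem_hardy hGh ((mem_modelSpace_iff u _).1 ψ.2).1 le_rfl
  have h1 : inner ℂ (mulOp zBar (incl u.toLinf)) (mulOp F (star (ψ : L2))) =
      conj (inner ℂ (zPow 0) (mulOp G ψ) : ℂ) := by
    rw [inner_eq_integral, inner_eq_integral, ← integral_conj]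
    refine integral_congr_ae ?_
    filter_upwards [coeFn_mulOp zBar (incl u.toLinf), coeFn_incl u.toLinf, coeFn_zBar,
      coeFn_mulOp F (star (ψ : L2)), Lp.coeFn_star (ψ : L2), coeFn_zPow 0, coeFn_mulOp G ψ, hGt]
      with t k1 k2 k3 k4 k5 k6 k7 k8
    rw [k1, k2, k3, k4, k5, k6, k7, k8, fourier_zero, fourier_neg, Pi.star_apply, RCLike.star_def]
    simp only [map_mul, Complex.conj_conj, map_one]
    ring
  have h2 : inner ℂ (mulOp zBar (incl u.toLinf)) (incl F) =
      conj (inner ℂ (zPow 0) (incl G) : ℂ) := by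
    rw [inner_eq_integral, inner_eq_integral, ← integral_conj]
    refine integral_congr_ae ?_
    filter_upwards [coeFn_mulOp zBar (incl u.toLinf), coeFn_incl u.toLinf, coeFn_zBar,
      coeFn_incl F, coeFn_zPow 0, coeFn_incl G, hGt] with t k1 k2 k3 k4 k5 k6 k7
    rw [k1, k2, k3, k4, k5, k6, k7, fourier_zero, fourier_neg]
    simp only [map_mul, Complex.conj_conj, map_one]
    ring
  rw [h1, h2, key, map_mul, mul_comm]

/-- On bounded functions, the truncated Toeplitz operator with symbol `φ + α · conj (S_u C φ) + c`
commutes with `S_u^α`. -/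
lemma proj_shiftInf_typeSymbol {α : ℂ} (hα : 1 - α * conj (diskValue u.toLinf 0) ≠ 0) {F : Linf}
    (hF : incl F ∈ modelSpace u) (φ : modelSpace u) (c : ℂ) :
    proj u (mulOp (shiftInf u α F) (typeSymbol u α φ c)) =
      genShift u α (proj u (mulOp F (typeSymbol u α φ c))) := by
  have hFh := ((mem_modelSpace_iff u _).1 hF).1
  have hφ := ((mem_modelSpace_iff u _).1 φ.2).1
  set X := inner ℂ (mulOp zBar (incl u.toLinf)) (mulOp F (φ : L2)) with hX
  set b := inner ℂ (mulOp zBar (incl u.toLinf)) (incl F) with hb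
  set φ₀ := inner ℂ (zPow 0) (φ : L2) with hφ₀
  set ψ₀ := companionValue u φ with hψ₀
  -- Fφ and cF lie in H², so only the conjugated term contributes at index -1.
  have hE : inner ℂ (zPow (-1)) (mulOp F (typeSymbol u α φ c)) = α * (X - φ₀ * b) := by
    rw [typeSymbol, map_add, map_add, map_smul, map_smul, inner_add_right, inner_add_right,
      inner_smul_right, inner_smul_right, inner_zPow_mulOp_star,
      (mem_hardy_iff_inner _).1 (mulOp_mem_hardy hFh hφ) _ (by norm_num), ← incl,
      (mem_hardy_iff_inner _).1 hFh _ (by norm_num)]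
    ring
  have hU : inner ℂ (mulOp zBar (incl u.toLinf)) (mulOp F (typeSymbol u α φ c)) =
      X + α * (conj ψ₀ * b) + c * b := by
    rw [typeSymbol, map_add, map_add, map_smul, map_smul, inner_add_right, inner_add_right,
      inner_smul_right, inner_smul_right, inner_incl_mulOp_star u hF, ← incl]
    rfl
  rw [mulOp_shiftInf, map_add, map_smul, map_sub, map_smul, proj_mulOp_zInf, proj_typeSymbol,
    proj_mulOp_typeSymbol, genShift_apply, ← Submodule.coe_inner, inner_proj,
    inner_conjC_kernelZero, hE, hU, ← hb, ← hφ₀, ← hψ₀]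
  -- The φ terms cancel and S_u P_u(FΦ) occurs on both sides; the k₀ coefficients agree by `hE` and
  -- `hU`.
  match_scalars <;> field_simp <;> ring

lemma hasSymbol_iff (A : modelSpace u →L[ℂ] modelSpace u) (Φ : L2) : HasSymbol u A Φ ↔
    ∀ (F : Linf) (hF : incl F ∈ modelSpace u), A ⟨incl F, hF⟩ = proj u (mulOp F Φ) := by
  constructor
  · intro h F hF
    have hf : MemLp (incl F) ∞ haarAddCircle := (Lp.memLp F).ae_eq (coeFn_incl F).symm
    rw [h ⟨incl F, hF⟩ hf]
    congr 3
    exact Lp.ext (hf.coeFn_toLp.trans (coeFn_incl F))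
  · intro h f hf
    have h1 : incl (hf.toLp (f : L2)) = f := Lp.ext ((coeFn_incl _).trans hf.coeFn_toLp)
    rw [← h (hf.toLp (f : L2)) (by rw [h1]; exact f.2)]
    congr 1
    exact Subtype.ext h1.symm

lemma isOfType_iff (α : ℂ) (A : modelSpace u →L[ℂ] modelSpace u) : IsOfType u α A ↔
    ∃ (φ : modelSpace u) (c : ℂ), HasSymbol u A (typeSymbol u α φ c) := by
  simp only [IsOfType, const_eq_smul_zPow, typeSymbol]

/-! ### Cyclicity of k₀ and density arguments. -/

/-- The projections of the monomials span a dense subspace of `K_u`. -/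
lemma dense_span_proj_zPow :
    Dense (Submodule.span ℂ (Set.range fun n : ℕ => proj u (zPow n)) : Set (modelSpace u)) := by
  rw [Submodule.dense_iff_topologicalClosure_eq_top, Submodule.topologicalClosure_eq_top_iff,
    Submodule.eq_bot_iff]
  intro g hg
  have h : ∀ n : ℤ, inner ℂ (zPow n) (g : L2) = 0 := by
    intro n
    rcases lt_or_ge n 0 with hn | hn
    · exact (mem_hardy_iff_inner _).1 ((mem_modelSpace_iff u _).1 g.2).1 n hn
    · lift n to ℕ using hn
      have := (Submodule.mem_orthogonal' _ _).1 hg _ (Submodule.subset_span ⟨n, rfl⟩)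
      rw [inner_proj] at this
      rw [← inner_conj_symm, this, map_zero]
  refine Subtype.ext (ext_inner_left ℂ fun v => ?_)
  rw [← HilbertBasis.tsum_inner_mul_inner fourierBasis, coe_fourierBasis]
  simp [h]

/-- A subspace of `K_u` which contains `k₀` and is invariant under `S_u^α` is dense. -/
lemma dense_of_kernelZero_mem {α : ℂ} (N : Submodule ℂ (modelSpace u)) (h0 : kernelZero u ∈ N)
    (hN : ∀ f ∈ N, genShift u α f ∈ N) : Dense (N : Set (modelSpace u)) := by
  refine (dense_span_proj_zPow u).mono (Submodule.span_le.2 ?_)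
  rintro _ ⟨n, rfl⟩
  induction n with
  | zero => rw [kernelZero_eq_proj] at h0; exact_mod_cast h0
  | succ n ih =>
    -- Removing the k₀ component from S_u^α P_u zⁿ leaves S_u P_u zⁿ, which is P_u zⁿ⁺¹ because zⁿ
    -- has no coefficient at -1.
    have h1 := sub_mem (hN _ ih) (N.smul_mem ((α / (1 - α * conj (diskValue u.toLinf 0))) *
      inner ℂ (conjC u (kernelZero u) : L2) (proj u (zPow n) : L2)) h0)
    rw [genShift_apply, add_sub_cancel_right] at h1
    have h2 := proj_mulOp_zInf u (zPow n)
    rw [mulOp_zInf_zPow, inner_zPow_zPow, if_neg (by omega), zero_smul, add_zero] at h2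
    change proj u (zPow ((n + 1 : ℕ) : ℤ)) ∈ N
    push_cast
    rwa [h2]

/-- The bounded functions `F ∈ K_u` with `A F = P_u (Φ F)`. -/
noncomputable def symbolDomain (A : modelSpace u →L[ℂ] modelSpace u) (Φ : L2) :
    Submodule ℂ (modelSpace u) where
  carrier := {f | ∃ F : Linf, incl F = f ∧ A f = proj u (mulOp F Φ)}
  zero_mem' := ⟨0, by simp [incl, mulOp], by simp [mulOp]⟩
  add_mem' := by
    rintro f g ⟨F, hF, hF'⟩ ⟨G, hG, hG'⟩
    refine ⟨F + G, ?_, ?_⟩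
    · rw [incl, mulOp_add_left, Submodule.coe_add, ← hF, ← hG, incl, incl]
    · rw [mulOp_add_left, map_add, map_add, hF', hG']
  smul_mem' := by
    rintro c f ⟨F, hF, hF'⟩
    refine ⟨c • F, ?_, ?_⟩
    · rw [incl, mulOp_smul_left, Submodule.coe_smul, ← hF, incl]
    · rw [mulOp_smul_left, map_smul, map_smul, hF']

/-- It is enough to test a symbol on a dense set of bounded functions. -/
lemma hasSymbol_of_dense (A : modelSpace u →L[ℂ] modelSpace u) (Φ : L2)
    (h : Dense (symbolDomain u A Φ : Set (modelSpace u))) : HasSymbol u A Φ := by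
  -- Tested against a bounded G, F ↦ P_u(FΦ) becomes a continuous functional of F, as G·conj Φ is in
  -- L².
  have swap : ∀ F G : Linf, inner ℂ (incl G) (mulOp F Φ) =
      inner ℂ (mulOp G (star Φ)) (incl F) := by
    intro F G
    rw [inner_eq_integral, inner_eq_integral]
    refine integral_congr_ae ?_
    filter_upwards [coeFn_incl F, coeFn_incl G, coeFn_mulOp F Φ, coeFn_mulOp G (star Φ),
      Lp.coeFn_star Φ] with t h1 h2 h3 h4 h5
    rw [h1, h2, h3, h4, h5, Pi.star_apply, RCLike.star_def, map_mul, Complex.conj_conj]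
    ring
  rw [hasSymbol_iff]
  intro F hF
  have hc : ∀ x : modelSpace u, Continuous fun g : modelSpace u => (inner ℂ g x : ℂ) := by
    intro x
    change Continuous fun g : modelSpace u => inner ℂ (g : L2) (x : L2)
    fun_prop
  have key : (fun g : modelSpace u => inner ℂ g (A ⟨incl F, hF⟩)) =
      fun g : modelSpace u => inner ℂ g (proj u (mulOp F Φ)) := by
    refine Continuous.ext_on h (hc _) (hc _) ?_
    rintro g ⟨G, hG, -⟩
    -- Density is used twice: here in f for a fixed bounded g, and above in g.
    have hcont : (fun f : modelSpace u => inner ℂ g (A f)) =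
        fun f : modelSpace u => inner ℂ (mulOp G (star Φ)) (f : L2) := by
      refine Continuous.ext_on h (continuous_const.inner A.continuous) (by fun_prop) ?_
      rintro f ⟨F', hF', hA⟩
      change inner ℂ g (A f) = inner ℂ (mulOp G (star Φ)) (f : L2)
      rw [hA, inner_proj, ← hF', ← hG, swap]
    change inner ℂ g (A ⟨incl F, hF⟩) = inner ℂ g (proj u (mulOp F Φ))
    rw [inner_proj, ← hG, swap]
    exact congrFun hcont ⟨incl F, hF⟩
  exact ext_inner_left ℂ fun g => congrFun key g

/-- The bounded functions are dense in `K_u`. -/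
lemma dense_bounded : Dense {f : modelSpace u | ∃ F : Linf, incl F = f} := by
  have h : Dense (symbolDomain u 0 0 : Set (modelSpace u)) := by
    -- With A = 0 and Φ = 0 the symbol condition is vacuous, so this domain is all bounded
    -- functions; α = 0 makes the denominator 1.
    refine dense_of_kernelZero_mem u (α := 0) _ ⟨kernelInf u, incl_kernelInf u, by simp⟩ ?_
    rintro f ⟨F, hF, -⟩
    have hF' : incl F ∈ modelSpace u := by rw [hF]; exact f.2
    refine ⟨shiftInf u 0 F, ?_, by simp⟩
    rw [incl_shiftInf u (by simp) hF']
    congr 2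
    exact Subtype.ext hF
  refine h.mono ?_
  rintro f ⟨F, hF, -⟩
  exact ⟨F, hF⟩

/-! ### The two implications. -/

lemma comp_genShift_of_isOfType {α : ℂ} (hα : 1 - α * conj (diskValue u.toLinf 0) ≠ 0)
    {A : modelSpace u →L[ℂ] modelSpace u} (hA : IsOfType u α A) :
    A ∘L genShift u α = genShift u α ∘L A := by
  obtain ⟨φ, c, h⟩ := (isOfType_iff u α A).1 hA
  rw [hasSymbol_iff] at h
  refine DFunLike.coe_injective (Continuous.ext_on (dense_bounded u) (by fun_prop) (by fun_prop) ?_)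
  rintro ⟨f, hf⟩ ⟨F, hF⟩
  obtain rfl : incl F = f := hF
  have hmem : incl (shiftInf u α F) ∈ modelSpace u := by
    rw [incl_shiftInf u hα hf]; exact Subtype.coe_prop _
  change A (genShift u α ⟨incl F, hf⟩) = genShift u α (A ⟨incl F, hf⟩)
  rw [h, ← proj_shiftInf_typeSymbol u hα hf, ← h _ hmem]
  congr 1
  exact Subtype.ext (incl_shiftInf u hα hf).symm

lemma isOfType_of_comp_genShift {α : ℂ} (hα : 1 - α * conj (diskValue u.toLinf 0) ≠ 0)
    {A : modelSpace u →L[ℂ] modelSpace u} (hA : A ∘L genShift u α = genShift u α ∘L A) :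
    IsOfType u α A := by
  -- Solves P_u(k₀Φ) = Ak₀: φ enters with factor 1 - α·conj(u(0)), and c cancels the k₀ term.
  set φ := (1 - α * conj (diskValue u.toLinf 0))⁻¹ • A (kernelZero u) with hφ
  set c := -(α * conj (companionValue u φ) +
    α * conj (diskValue u.toLinf 0) * inner ℂ (zPow 0) (φ : L2)) with hc
  refine (isOfType_iff u α A).2 ⟨φ, c, hasSymbol_of_dense u A _ ?_⟩
  refine dense_of_kernelZero_mem u (α := α) _ ⟨kernelInf u, incl_kernelInf u, ?_⟩ ?_
  · have hz : c + α * conj (companionValue u φ) +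
        α * conj (diskValue u.toLinf 0) * inner ℂ (zPow 0) (φ : L2) = 0 := by
      rw [hc]; ring
    rw [proj_kernelInf_typeSymbol, hz, zero_smul, add_zero, hφ, smul_inv_smul₀ hα]
  · rintro ⟨f, hf⟩ ⟨F, hF, hAF⟩
    obtain rfl : incl F = f := hF
    refine ⟨shiftInf u α F, incl_shiftInf u hα hf, ?_⟩
    rw [proj_shiftInf_typeSymbol u hα hf, ← hAF]
    exact congrArg (fun T => T ⟨incl F, hf⟩) hA

end TTO

theorem mainTheorem3 (u : TTO.InnerFunction) (hu : u.Nonconstant) (α : ℂ) (hα : ‖α‖ ≤ 1)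
    (A : TTO.modelSpace u →L[ℂ] TTO.modelSpace u) :
    TTO.IsOfType u α A ↔ A ∘L TTO.genShift u α = TTO.genShift u α ∘L A :=
  have h := TTO.one_sub_mul_conj_diskValue_ne_zero u hu hα
  ⟨TTO.comp_genShift_of_isOfType u h, TTO.isOfType_of_comp_genShift u h⟩
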